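/- Let $d$ and $k$ be integers with $1\le k\le d-1$ and let $\varepsilon\in(0,1)$. There are a positive integer $r=r(d,\varepsilon,k)$ and a real constant $c=c(d,\varepsilon,k)>0$, depending only on $d$, $\varepsilon$ and $k$, such that the following holds. Let $\Lambda\subset\mathbb{R}^d$ be a $d$-dimensional lattice (the set of all integer linear combinations of $d$ linearly independent vectors of $\mathbb{R}^d$) and let $K\subset\mathbb{R}^d$ be a compact convex body with nonempty interior that is symmetric about the origin, $K=-K$. For $1\le i\le d$ let $$\lambda_i=\lambda_i(\Lambda,K)=\inf\{\lambda\ge 0:\ \dim(\Lambda\cap\lambda K)\ge i\}$$ be the $i$-th successive minimum of $\Lambda$ and $K$, where $\dim(X)$ denotes the dimension of the affine hull of $X$, and let $$\beta=\min_{1\le j\le d-1}(\lambda_j\lambda_{j+1}\cdots\lambda_d)^{-1/(d-j)}.$$ If $\lambda_d\le 1$, then there is a finite set $S\subseteq\Lambda\cap K$ with $$|S|\ \ge\ c\,\bigl((1-\lambda_d)\beta\bigr)^{d-k-\varepsilon}$$ such that every $k$-dimensional linear subspace of $\mathbb{R}^d$ contains at most $r-1$ points of $S$. -/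

import Mathlib

open scoped Pointwise

noncomputable section

/-- The `i`-th successive minimum `λ_i(Λ, K)` of a lattice `Λ` and a convex body `K` in `ℝ^d`: the
infimum of the scalars `t ≥ 0` for which the affine hull of `Λ ∩ t K` has dimension at least `i`
(the dimension of the affine hull of a set is that of its direction, the `vectorSpan`). It is used
for `1 ≤ i ≤ d`. -/
def successiveMinimum {d : ℕ} (Λ : Submodule ℤ (EuclideanSpace ℝ (Fin d)))
    (K : ConvexBody (EuclideanSpace ℝ (Fin d))) (i : ℕ) : ℝ :=
  sInf {t : ℝ | 0 ≤ t ∧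
    i ≤ Module.finrank ℝ (vectorSpan ℝ
      ((Λ : Set (EuclideanSpace ℝ (Fin d))) ∩ t • (K : Set (EuclideanSpace ℝ (Fin d)))))}

/-- `β = min_{1 ≤ j ≤ d-1} (λ_j ⋯ λ_d)^(-1/(d-j))`, where `λ_i` is the `i`-th successive minimum.
For `d ≥ 2` this is the infimum of a nonempty finite set of reals, that is, its minimum. -/
def minimaBeta {d : ℕ} (Λ : Submodule ℤ (EuclideanSpace ℝ (Fin d)))
    (K : ConvexBody (EuclideanSpace ℝ (Fin d))) : ℝ :=
  sInf ((fun j : ℕ => (∏ i ∈ Finset.Icc j d, successiveMinimum Λ K i) ^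
    (-1 / ((d : ℝ) - (j : ℝ)))) '' Set.Icc 1 (d - 1))

end

/-!
The set `S` is a random set of lines over a finite field, lifted to short lattice vectors. Write
`d = n + 1`, `δ = 1 - λ_d`, and let `v_1, …, v_d` be linearly independent vectors of `Λ` with
`v_i ∈ λ_i K` (`exists_linearIndependent_successiveMinimum`). Let `p` be a prime of the order of
magnitude of `δ β`; if `δ β` is bounded, a single point is enough.

Lifting: for every `y ∈ F_p ^ n` there is an integer vector `(a, t)`, with `a ≡ t y` modulo `p` and
`0 < t < p`, for which the lattice point `a_1 v_1 + ⋯ + a_n v_n + t v_d` lies in `K`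
(`exists_representatives_mem`). It suffices that `(a, t)` lies in a box whose sides are of order
`δ / λ_i`, but at least `1` for the last coordinate, and the box principle provides such a vector
(`exists_small_multiple`). The sides longer than `p` impose no condition; the other ones belong to
the indices `j, …, d` for some `j`, and there the inequality `β ^ (d - j) λ_j ⋯ λ_d ≤ 1` is what the
box principle needs (`prod_ceil_le_and_lt`, `two_mul_pow_le_prod_box`).

Few points in subspaces: the integer coefficient vectors of the lattice points in a `k`-dimensional
real subspace form a group of rank at most `k`, so they reduce modulo `p` into the span of `k`
vectors (`image_integerCombination_few`). Such a span contains at most `p ^ (k - 1)` of the points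
`(y, 1)` (`card_slice_span_le`) and there are at most `p ^ (d k)` of these spans, so about
`p ^ (d - k - ε)` random points `y` have fewer than `r` in each of them once `ε r > d k`
(`exists_function_card_hits_lt`, `exists_random_selection`).
-/

open scoped Topology

/-! ### Selection and approximation over finite fields -/

/-- The union bound of the probabilistic method, as a count. A uniformly random `f : Fin N → X` has
at least `r` indices landing in a given `A g` with probability at most `N ^ r * (m / |X|) ^ r`, so
if this is less than `1 / |G|`, some `f` is good for every `g` at once. -/
theorem exists_function_card_hits_lt {X G : Type*} [Fintype X] [DecidableEq X] [Fintype G]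
    (A : G → Finset X) {m N r : ℕ} (hr : 0 < r) (hA : ∀ g, (A g).card ≤ m)
    (h : Fintype.card G * (N ^ r * m ^ r) < Fintype.card X ^ r) :
    ∃ f : Fin N → X, ∀ g, (Finset.univ.filter fun i => f i ∈ A g).card < r := by
  classical
  by_contra! hbad
  have hX : 0 < Fintype.card X := by
    rcases Nat.eq_zero_or_pos (Fintype.card X) with h0 | h0
    · rw [h0, zero_pow hr.ne'] at h
      omega
    · exact h0
  obtain ⟨x₀⟩ := Fintype.card_pos_iff.mp hX
  have hrN : r ≤ N := by
    obtain ⟨g, hg⟩ := hbad fun _ => x₀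
    exact hg.trans ((Finset.card_le_univ _).trans (by simp))
  let B : G × Finset (Fin N) → Finset (Fin N → X) := fun q =>
    Fintype.piFinset fun i => if i ∈ q.2 then A q.1 else Finset.univ
  have hcover : (Finset.univ : Finset (Fin N → X)) ⊆
      (Finset.univ ×ˢ Finset.powersetCard r Finset.univ).biUnion B := by
    intro f _
    obtain ⟨g, hg⟩ := hbad f
    obtain ⟨R, hRsub, hRcard⟩ := Finset.exists_subset_card_eq hg
    refine Finset.mem_biUnion.mpr ⟨(g, R), by simp [hRcard], ?_⟩
    refine Fintype.mem_piFinset.mpr fun i => ?_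
    by_cases hi : i ∈ R
    · simpa [hi] using hRsub hi
    · simp [hi]
  have hB : ∀ q ∈ (Finset.univ : Finset G) ×ˢ Finset.powersetCard r (Finset.univ : Finset (Fin N)),
      (B q).card ≤ m ^ r * Fintype.card X ^ (N - r) := by
    rintro ⟨g, R⟩ hq
    have hR : R.card = r := by simpa using hq
    have hRc : (Finset.univ.filter fun i => i ∉ R).card = N - r := by
      have : (Finset.univ.filter fun i => i ∉ R) = Rᶜ := by ext; simp
      rw [this, Finset.card_compl, hR, Fintype.card_fin]
    calc (B (g, R)).card = ∏ i, if i ∈ R then (A g).card else Fintype.card X := by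
          simp only [B, Fintype.card_piFinset]
          refine Finset.prod_congr rfl fun i _ => ?_
          split_ifs <;> simp
      _ = (A g).card ^ r * Fintype.card X ^ (N - r) := by
          rw [Finset.prod_ite, Finset.prod_const, Finset.prod_const, hRc]
          simp [hR]
      _ ≤ _ := by gcongr; exact hA g
  have hcount := (Finset.card_le_card hcover).trans (Finset.card_biUnion_le_card_mul _ _ _ hB)
  rw [Finset.card_product, Finset.card_powersetCard, Finset.card_univ, Finset.card_univ,
    Finset.card_univ, Fintype.card_fun, Fintype.card_fin] at hcount
  have hsplit : Fintype.card X ^ N = Fintype.card X ^ r * Fintype.card X ^ (N - r) := by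
    rw [← pow_add, Nat.add_sub_cancel' hrN]
  have hchoose : Fintype.card G * N.choose r * (m ^ r * Fintype.card X ^ (N - r)) ≤
      Fintype.card G * (N ^ r * m ^ r) * Fintype.card X ^ (N - r) := by
    calc _ ≤ Fintype.card G * N ^ r * (m ^ r * Fintype.card X ^ (N - r)) := by
          gcongr; exact Nat.choose_le_pow N r
      _ = _ := by ring
  have hlt := Nat.mul_lt_mul_of_pos_right h (pow_pos hX (N - r))
  omega

/-- The slice of a subspace `W ⊆ V × F` at height `1` has at most `|W| / |F|` points: with a base
point `y₀` of the slice, `(y, t) ↦ (y - y₀, 0) + t • (y₀, 1)` embeds `A × F` into `W`. -/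
theorem card_slice_mul_card_le {F V : Type*} [Field F] [Fintype F] [AddCommGroup V] [Module F V]
    [Fintype V] (W : Submodule F (V × F)) (A : Finset V)
    (hA : ∀ y ∈ A, (y, (1 : F)) ∈ W) : A.card * Fintype.card F ≤ Nat.card W := by
  classical
  -- The embedding needs a base point, which exists unless `A` is empty.
  rcases A.eq_empty_or_nonempty with rfl | ⟨y₀, hy₀⟩
  · simp
  have hinj : Function.Injective fun q : A × F =>
      (⟨((q.1 : V), (1 : F)) - (y₀, 1) + q.2 • (y₀, (1 : F)),
        W.add_mem (W.sub_mem (hA _ q.1.2) (hA _ hy₀)) (W.smul_mem _ (hA _ hy₀))⟩ : W) := by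
    rintro ⟨⟨y, hy⟩, t⟩ ⟨⟨y', hy'⟩, t'⟩ h
    simp only [Subtype.mk.injEq, Prod.ext_iff, Prod.fst_add, Prod.snd_add, Prod.fst_sub,
      Prod.snd_sub, Prod.smul_fst, Prod.smul_snd, sub_self, zero_add, smul_eq_mul, mul_one] at h
    obtain ⟨h1, rfl⟩ := h
    have : y = y' := by simpa using h1
    subst this
    rfl
  have := Nat.card_le_card_of_injective _ hinj
  simpa [Nat.card_prod] using this

theorem card_slice_span_le {F V : Type*} [Field F] [Fintype F] [AddCommGroup V] [Module F V]
    [Fintype V] {k : ℕ} (g : Fin (k + 1) → V × F) (A : Finset V)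
    (hA : ∀ y ∈ A, (y, (1 : F)) ∈ Submodule.span F (Set.range g)) :
    A.card ≤ Fintype.card F ^ k := by
  have h1 := card_slice_mul_card_le _ A hA
  have h2 : Nat.card (Submodule.span F (Set.range g)) ≤ Fintype.card F ^ (k + 1) := by
    rw [Module.natCard_eq_pow_finrank (K := F), Nat.card_eq_fintype_card]
    exact Nat.pow_le_pow_right Fintype.card_pos ((finrank_range_le_card g).trans (by simp))
  rw [pow_succ] at h2
  exact Nat.le_of_mul_le_mul_right (h1.trans h2) Fintype.card_pos

/-- Simultaneous Dirichlet approximation modulo `p`, with a separate bound `M i` for every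
coordinate. The box principle is applied to the multiples `0 • y, …, T • y` and the division of
`(ZMod p) ^ n` into `T = ∏ ⌈p / M i⌉` boxes. -/
theorem exists_small_multiple {n p : ℕ} [NeZero p] (M : Fin n → ℝ) (hM : ∀ i, 0 < M i)
    (y : Fin n → ZMod p) :
    ∃ t : ℤ, 0 < t ∧ t ≤ ∏ i, (⌈(p : ℝ) / M i⌉₊ : ℤ) ∧
      ∃ a : Fin n → ℤ, (∀ i, |(a i : ℝ)| ≤ M i) ∧ ∀ i, (a i : ZMod p) = t * y i := by
  have hp : 0 < p := Nat.pos_of_ne_zero (NeZero.ne p)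
  have hpR : (0 : ℝ) < p := by exact_mod_cast hp
  set m : Fin n → ℕ := fun i => ⌈(p : ℝ) / M i⌉₊ with hm
  set T := ∏ i, m i with hT
  have hmpos : ∀ i, 0 < m i := fun i => Nat.ceil_pos.mpr (div_pos hpR (hM i))
  let box : Fin (T + 1) → (∀ i, Fin (m i)) := fun t i =>
    ⟨((t : ℕ) * y i : ZMod p).val * m i / p, by
      rw [Nat.div_lt_iff_lt_mul hp, mul_comm]
      exact Nat.mul_lt_mul_of_pos_left (ZMod.val_lt _) (hmpos i)⟩
  obtain ⟨s, s', hne, hbox⟩ : ∃ s s' : Fin (T + 1), s ≠ s' ∧ box s = box s' :=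
    Fintype.exists_ne_map_eq_of_card_lt box (by simp [hT])
  wlog hlt : s' < s generalizing s s'
  · exact this s' s hne.symm hbox.symm (lt_of_le_of_ne (not_lt.mp hlt) hne)
  refine ⟨(s : ℤ) - s', by have : (s' : ℕ) < s := hlt; omega, ?_, fun i =>
    (((s : ℕ) * y i : ZMod p).val : ℤ) - ((s' : ℕ) * y i : ZMod p).val, fun i => ?_, fun i => ?_⟩
  · have h1 : (s : ℕ) ≤ T := Nat.lt_succ_iff.mp s.2
    have h2 : (∏ i, (m i : ℤ)) = T := by simp [hT]
    rw [h2]; omega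
  · set u := ((s : ℕ) * y i : ZMod p).val
    set u' := ((s' : ℕ) * y i : ZMod p).val
    have hq : u * m i / p = u' * m i / p := by simpa [box] using congrArg Fin.val (congrFun hbox i)
    have hd := Nat.div_add_mod (u * m i) p
    have hd' := Nat.div_add_mod (u' * m i) p
    have hlt1 := Nat.mod_lt (u * m i) hp
    have hlt2 := Nat.mod_lt (u' * m i) hp
    rw [hq] at hd
    have habs : |((u * m i : ℕ) : ℤ) - (u' * m i : ℕ)| ≤ p := by rw [abs_le]; omega
    have habsR : |(u : ℝ) - u'| * m i ≤ p := by
      rw [← abs_of_pos (show (0 : ℝ) < m i by exact_mod_cast hmpos i), ← abs_mul, sub_mul]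
      exact_mod_cast habs
    have hceil : (p : ℝ) ≤ M i * m i := by
      have := Nat.le_ceil ((p : ℝ) / M i)
      rwa [div_le_iff₀ (hM i), mul_comm] at this
    have := le_of_mul_le_mul_right (habsR.trans hceil) (by exact_mod_cast hmpos i)
    exact_mod_cast this
  · push_cast
    simp [sub_mul]

/-- The number of boxes needed in `exists_small_multiple` is at most the bound `D` on the
multiplier, and less than `p`. A side `M i ≥ p` leaves its coordinate free (one box); as `M` is
decreasing, these are the coordinates below some `j`, and the hypothesis for this `j` bounds the
product of the remaining factors, each at most `2 p / M i`. -/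
theorem prod_ceil_le_and_lt {n p : ℕ} (hp : 1 < p) (M : ℕ → ℝ) (D : ℝ)
    (hM : ∀ i < n, 0 < M i) (hanti : ∀ i j, i ≤ j → j < n → M j ≤ M i) (hD : 1 ≤ D)
    (hDM : D = 1 ∨ ∀ i < n, D ≤ M i)
    (hprod : ∀ j < n, (2 * (p : ℝ)) ^ (n - j) ≤ (∏ i ∈ Finset.Ico j n, M i) * D) :
    ((∏ i ∈ Finset.range n, ⌈(p : ℝ) / M i⌉₊ : ℕ) : ℝ) ≤ D ∧
      ∏ i ∈ Finset.range n, ⌈(p : ℝ) / M i⌉₊ < p := by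
  have hpR : (1 : ℝ) < p := by exact_mod_cast hp
  have hone : ∀ i < n, (p : ℝ) ≤ M i → ⌈(p : ℝ) / M i⌉₊ = 1 := by
    intro i hi hpi
    refine le_antisymm (Nat.ceil_le.mpr ?_) (Nat.ceil_pos.mpr (div_pos (by linarith) (hM i hi)))
    rw [Nat.cast_one, div_le_one (hM i hi)]
    exact hpi
  classical
  by_cases hex : ∃ j, j < n ∧ M j < p
  · set j := Nat.find hex with hj
    obtain ⟨hjn, hjp⟩ := Nat.find_spec hex
    have hmin : ∀ i < j, (p : ℝ) ≤ M i := by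
      intro i hi
      have := Nat.find_min hex hi
      push Not at this
      exact this (hi.trans hjn)
    have hle : ((∏ i ∈ Finset.range n, ⌈(p : ℝ) / M i⌉₊ : ℕ) : ℝ) ≤ D := by
      rw [← Finset.prod_range_mul_prod_Ico _ hjn.le,
        Finset.prod_eq_one fun i hi => hone i ((Finset.mem_range.mp hi).trans hjn)
          (hmin i (Finset.mem_range.mp hi)), one_mul, Nat.cast_prod]
      have hPpos : 0 < ∏ i ∈ Finset.Ico j n, M i :=
        Finset.prod_pos fun i hi => hM i (Finset.mem_Ico.mp hi).2
      calc ∏ i ∈ Finset.Ico j n, ((⌈(p : ℝ) / M i⌉₊ : ℕ) : ℝ)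
          ≤ ∏ i ∈ Finset.Ico j n, (2 * (p : ℝ)) / M i := by
            refine Finset.prod_le_prod (fun _ _ => Nat.cast_nonneg _) fun i hi => ?_
            obtain ⟨h1, h2⟩ := Finset.mem_Ico.mp hi
            have hlt : M i < p := (hanti j i h1 h2).trans_lt hjp
            have h3 := Nat.ceil_lt_add_one (div_pos (by linarith) (hM i h2) : 0 < (p : ℝ) / M i).le
            have h4 : 1 ≤ (p : ℝ) / M i := (one_le_div (hM i h2)).mpr hlt.le
            rw [mul_div_assoc]
            linarith
        _ = (2 * (p : ℝ)) ^ (n - j) / ∏ i ∈ Finset.Ico j n, M i := by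
            rw [Finset.prod_div_distrib, Finset.prod_const, Nat.card_Ico]
        _ ≤ D := by
            rw [div_le_iff₀ hPpos, mul_comm D]
            exact hprod j hjn
    refine ⟨hle, ?_⟩
    have hDp : D < p := by
      rcases hDM with rfl | h
      · exact hpR
      · exact (h j hjn).trans_lt hjp
    exact_mod_cast hle.trans_lt hDp
  · push Not at hex
    rw [Finset.prod_eq_one fun i hi => hone i (Finset.mem_range.mp hi)
      (hex i (Finset.mem_range.mp hi))]
    exact ⟨by simpa using hD, hp⟩

/-! ### Successive minima and the gauge -/

section
variable {E : Type*} [NormedAddCommGroup E] [NormedSpace ℝ E]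

theorem zero_mem_interior_of_neg_eq {K : Set E} (hK : Convex ℝ K) (hsymm : -K = K)
    (hint : (interior K).Nonempty) : (0 : E) ∈ interior K := by
  obtain ⟨x, hx⟩ := hint
  have hx' : -x ∈ interior K := by
    have : -x ∈ -interior K := by simpa using hx
    have h2 : -interior K ⊆ interior K := by
      apply interior_maximal
      · intro y hy
        rw [← hsymm]
        exact Set.mem_neg.mpr (interior_subset (Set.mem_neg.mp hy))
      · exact isOpen_interior.neg
    exact h2 this
  have := hK.interior hx hx' (show (0 : ℝ) ≤ 1 / 2 by norm_num) (show (0 : ℝ) ≤ 1 / 2 by norm_num)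
    (by norm_num)
  simpa using this

theorem mem_smul_iff_gauge_le {K : Set E} (hK : Convex ℝ K) (hc : IsCompact K)
    (h0 : K ∈ 𝓝 (0 : E)) {t : ℝ} (ht : 0 ≤ t) (x : E) : x ∈ t • K ↔ gauge K x ≤ t := by
  rcases ht.eq_or_lt with rfl | ht
  · rw [Set.zero_smul_set ⟨0, mem_of_mem_nhds h0⟩, Set.mem_zero,
      (gauge_nonneg x).ge_iff_eq', gauge_eq_zero (absorbent_nhds_zero h0)
        ((NormedSpace.isVonNBounded_iff ℝ).mpr hc.isBounded)]
  · rw [Set.mem_smul_set_iff_inv_smul_mem₀ ht.ne']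
    have h := gauge_le_one_iff_mem_closure (x := t⁻¹ • x) hK h0
    rw [hc.isClosed.closure_eq, gauge_smul_of_nonneg (inv_nonneg.mpr ht.le), smul_eq_mul,
      inv_mul_le_one₀ ht] at h
    exact h.symm

/-- The triangle inequality for integer combinations; the gauge of a symmetric convex body is a
seminorm. -/
theorem gauge_sum_zsmul_le {K : Set E} (hK : Convex ℝ K) (hsymm : -K = K) (h0 : K ∈ 𝓝 (0 : E))
    {ι : Type*} (s : Finset ι) (a : ι → ℤ) (v : ι → E) :
    gauge K (∑ i ∈ s, a i • v i) ≤ ∑ i ∈ s, |(a i : ℝ)| * gauge K (v i) := by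
  have hneg : ∀ x ∈ K, -x ∈ K := fun x hx => by rw [← hsymm]; simpa using hx
  have habs := absorbent_nhds_zero (𝕜 := ℝ) h0
  classical
  induction s using Finset.induction_on with
  | empty => simp
  | insert i s hi ih =>
    rw [Finset.sum_insert hi, Finset.sum_insert hi]
    refine (gauge_add_le hK habs _ _).trans (add_le_add (le_of_eq ?_) ih)
    rw [← Int.cast_smul_eq_zsmul ℝ]
    rcases le_total 0 (a i : ℝ) with h | h
    · rw [gauge_smul_of_nonneg h, abs_of_nonneg h, smul_eq_mul]
    · rw [← gauge_neg hneg, ← neg_smul, gauge_smul_of_nonneg (neg_nonneg.mpr h), abs_of_nonpos h,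
        smul_eq_mul]
end

section
variable {d : ℕ} {Λ : Submodule ℤ (EuclideanSpace ℝ (Fin d))}
  {K : ConvexBody (EuclideanSpace ℝ (Fin d))}

/-- The successive minima in terms of the gauge of `K` and of linear spans; the affine hull is a
linear span because `0` lies in `Λ ∩ t K`. -/
theorem successiveMinimum_eq (hK : (K : Set (EuclideanSpace ℝ (Fin d))) ∈ 𝓝 0) (i : ℕ) :
    successiveMinimum Λ K i = sInf {t : ℝ | 0 ≤ t ∧
      i ≤ Module.finrank ℝ (Submodule.span ℝ {x | x ∈ Λ ∧ gauge K x ≤ t})} := by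
  unfold successiveMinimum
  congr 1
  ext t
  refine and_congr_right fun ht => ?_
  have h1 : (Λ : Set (EuclideanSpace ℝ (Fin d))) ∩ t • (K : Set (EuclideanSpace ℝ (Fin d))) =
      {x | x ∈ Λ ∧ gauge K x ≤ t} := by
    ext x
    simp [mem_smul_iff_gauge_le K.convex K.isCompact hK ht]
  have h0 : (0 : EuclideanSpace ℝ (Fin d)) ∈ {x | x ∈ Λ ∧ gauge K x ≤ t} :=
    ⟨Λ.zero_mem, by simpa using ht⟩
  have h2 : vectorSpan ℝ {x | x ∈ Λ ∧ gauge K x ≤ t} =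
      Submodule.span ℝ {x | x ∈ Λ ∧ gauge K x ≤ t} := by
    rw [vectorSpan_eq_span_vsub_set_right ℝ h0]
    simp only [vsub_eq_sub, sub_zero, Set.image_id']
  rw [h1, h2]

theorem finite_gauge_le [DiscreteTopology Λ]
    (hK : (K : Set (EuclideanSpace ℝ (Fin d))) ∈ 𝓝 0) (t : ℝ) :
    {x | x ∈ Λ ∧ gauge K x ≤ t}.Finite := by
  rcases lt_or_ge t 0 with ht | ht
  · refine Set.Finite.subset Set.finite_empty fun x hx => ?_
    exact absurd (gauge_nonneg x) (not_le.mpr (hx.2.trans_lt ht))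
  have : DiscreteTopology Λ.toAddSubgroup := ‹DiscreteTopology Λ›
  have hclosed : IsClosed (Λ : Set (EuclideanSpace ℝ (Fin d))) :=
    AddSubgroup.isClosed_of_discrete (H := Λ.toAddSubgroup)
  have hdisc : IsDiscrete (Λ : Set (EuclideanSpace ℝ (Fin d))) := DiscreteTopology.isDiscrete
  refine (Metric.finite_isBounded_inter_isClosed hdisc
    (K.isCompact.smul t).isBounded hclosed).subset fun x hx => ⟨?_, hx.1⟩
  exact (mem_smul_iff_gauge_le K.convex K.isCompact hK ht x).mpr hx.2

theorem exists_span_gauge_le_eq_top (Λ : Submodule ℤ (EuclideanSpace ℝ (Fin d)))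
    [DiscreteTopology Λ] [IsZLattice ℝ Λ] (K : ConvexBody (EuclideanSpace ℝ (Fin d))) :
    ∃ t : ℝ, 0 ≤ t ∧ Submodule.span ℝ {x | x ∈ Λ ∧ gauge K x ≤ t} = ⊤ := by
  have := ZLattice.module_finite ℝ Λ
  have := ZLattice.module_free ℝ Λ
  let b := Module.Free.chooseBasis ℤ Λ
  refine ⟨∑ i, gauge K (b i : EuclideanSpace ℝ (Fin d)),
    Finset.sum_nonneg fun i _ => gauge_nonneg _, ?_⟩
  rw [eq_top_iff, ← IsZLattice.span_top (K := ℝ) (L := Λ), Submodule.span_le]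
  intro x hx
  have h1 : ((⟨x, hx⟩ : Λ) : EuclideanSpace ℝ (Fin d)) =
      ∑ i, (b.repr ⟨x, hx⟩ i) • (b i : EuclideanSpace ℝ (Fin d)) := by
    simpa only [map_sum, map_zsmul, Submodule.subtype_apply] using
      (congrArg Λ.subtype (b.sum_repr ⟨x, hx⟩)).symm
  rw [show x = ((⟨x, hx⟩ : Λ) : EuclideanSpace ℝ (Fin d)) from rfl, h1]
  refine Submodule.sum_mem _ fun i _ => ?_
  refine zsmul_mem (Submodule.subset_span (Set.mem_ofPred.mpr ⟨(b i).2, ?_⟩)) _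
  exact Finset.single_le_sum (f := fun i => gauge K (b i : EuclideanSpace ℝ (Fin d)))
    (fun i _ => gauge_nonneg _) (Finset.mem_univ i)

variable [DiscreteTopology Λ] [IsZLattice ℝ Λ]

/-- The infimum defining a successive minimum is attained, because only finitely many lattice points
have gauge at most `λ_i + 1`, so that the lattice points of `t K` and `λ_i K` agree for `t` slightly
larger than `λ_i`. -/
theorem le_finrank_span_successiveMinimum (hK : (K : Set (EuclideanSpace ℝ (Fin d))) ∈ 𝓝 0)
    {i : ℕ} (hi : i ≤ d) : 0 ≤ successiveMinimum Λ K i ∧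
      i ≤ Module.finrank ℝ
        (Submodule.span ℝ {x | x ∈ Λ ∧ gauge K x ≤ successiveMinimum Λ K i}) := by
  set S := {t : ℝ | 0 ≤ t ∧
      i ≤ Module.finrank ℝ (Submodule.span ℝ {x | x ∈ Λ ∧ gauge K x ≤ t})} with hS
  have hne : S.Nonempty := by
    obtain ⟨t, ht, htop⟩ := exists_span_gauge_le_eq_top Λ K
    exact ⟨t, ht, by rw [htop]; simpa using hi⟩
  rw [successiveMinimum_eq hK]
  refine ⟨Real.sInf_nonneg fun t ht => ht.1, ?_⟩
  have hev : ∀ᶠ t in 𝓝[>] (sInf S), ∀ x ∈ {x | x ∈ Λ ∧ gauge K x ≤ sInf S + 1},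
      gauge K x ≤ t → gauge K x ≤ sInf S := by
    rw [Filter.eventually_all_finite (finite_gauge_le hK _)]
    intro x _
    rcases le_or_gt (gauge K x) (sInf S) with h | h
    · exact Filter.Eventually.of_forall fun _ _ => h
    · filter_upwards [Ioo_mem_nhdsGT h] with t ht h'
      exact absurd h' (not_le.mpr ht.2)
  have hev' : ∀ᶠ t in 𝓝[>] (sInf S), t ∈ Set.Ioo (sInf S) (sInf S + 1) :=
    Ioo_mem_nhdsGT (by linarith)
  obtain ⟨t, ht, ht'⟩ := (hev.and hev').exists
  obtain ⟨s, hs, hst⟩ := exists_lt_of_csInf_lt hne ht'.1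
  refine hs.2.trans (Submodule.finrank_mono (Submodule.span_mono fun x hx => ⟨hx.1, ?_⟩))
  have h1 : gauge K x ≤ t := hx.2.trans hst.le
  exact ht x ⟨hx.1, h1.trans ht'.2.le⟩ h1

theorem successiveMinimum_pos (hK : (K : Set (EuclideanSpace ℝ (Fin d))) ∈ 𝓝 0)
    {i : ℕ} (hi : i ≤ d) (hi0 : 0 < i) : 0 < successiveMinimum Λ K i := by
  obtain ⟨h1, h2⟩ := le_finrank_span_successiveMinimum (Λ := Λ) hK hi
  refine h1.lt_of_ne fun h0 => ?_
  rw [← h0] at h2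
  have hbot : Submodule.span ℝ {x | x ∈ Λ ∧ gauge K x ≤ 0} = ⊥ := by
    rw [Submodule.span_eq_bot]
    intro x hx
    have := (mem_smul_iff_gauge_le K.convex K.isCompact hK le_rfl x).mpr hx.2
    rw [Set.zero_smul_set K.nonempty] at this
    simpa using this
  rw [hbot, finrank_bot] at h2
  omega

theorem successiveMinimum_mono (hK : (K : Set (EuclideanSpace ℝ (Fin d))) ∈ 𝓝 0)
    {i j : ℕ} (hij : i ≤ j) (hj : j ≤ d) :
    successiveMinimum Λ K i ≤ successiveMinimum Λ K j := by
  obtain ⟨h1, h2⟩ := le_finrank_span_successiveMinimum (Λ := Λ) hK hj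
  rw [successiveMinimum_eq hK i]
  exact csInf_le ⟨0, fun t ht => ht.1⟩ ⟨h1, hij.trans h2⟩

/-- Linearly independent lattice vectors attaining the successive minima. The index is shifted: the
vector `v i`, with `i` counted from `0`, belongs to the minimum number `i + 1`. -/
theorem exists_linearIndependent_successiveMinimum
    (hK : (K : Set (EuclideanSpace ℝ (Fin d))) ∈ 𝓝 0) {m : ℕ} (hm : m ≤ d) :
    ∃ v : Fin m → EuclideanSpace ℝ (Fin d), LinearIndependent ℝ v ∧
      ∀ i, v i ∈ Λ ∧ gauge K (v i) ≤ successiveMinimum Λ K (i + 1) := by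
  induction m with
  | zero => exact ⟨Fin.elim0, linearIndependent_empty_type, fun i => i.elim0⟩
  | succ m ih =>
    obtain ⟨v, hv, hvΛ⟩ := ih (by omega)
    have h2 := (le_finrank_span_successiveMinimum (Λ := Λ) hK hm).2
    obtain ⟨x, hx, hxv⟩ : ∃ x ∈ {x | x ∈ Λ ∧ gauge K x ≤ successiveMinimum Λ K (m + 1)},
        x ∉ Submodule.span ℝ (Set.range v) := by
      by_contra! hall
      have := Submodule.finrank_mono (Submodule.span_le.mpr hall)
      have h3 := finrank_range_le_card (R := ℝ) v
      rw [Fintype.card_fin] at h3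
      have h4 := h2.trans (this.trans h3)
      omega
    refine ⟨Fin.snoc v x, hv.finSnoc hxv, Fin.lastCases ?_ fun i => ?_⟩
    · simpa using hx
    · simpa using hvΛ i

end

/-! ### Real subspaces and reduction modulo `p` -/

theorem finrank_int_le_of_le {E : Type*} [NormedAddCommGroup E] [NormedSpace ℝ E]
    [FiniteDimensional ℝ E] {Λ L : Submodule ℤ E} [DiscreteTopology Λ] (hL : L ≤ Λ)
    (V : Submodule ℝ E) (hV : (L : Set E) ⊆ V) :
    Module.finrank ℤ L ≤ Module.finrank ℝ V := by
  have hdisc : DiscreteTopology (Submodule.span ℤ (L : Set E)) := by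
    rw [Submodule.span_eq]
    exact DiscreteTopology.of_subset (s := (Λ : Set E)) ‹_› hL
  have h := Real.finrank_eq_int_finrank_of_discrete hdisc
  rw [Set.finrank, Set.finrank, Submodule.span_eq] at h
  rw [← h]
  exact Submodule.finrank_mono (Submodule.span_le.mpr hV)

/-- The image of a subgroup of rank at most `k` under a homomorphism to an `F`-vector space is
contained in the span of `k` vectors. The family `g` is a basis of `N`, mapped and padded with
zeros. -/
theorem exists_span_reduction {A F U : Type*} [AddCommGroup A] [Module.Free ℤ A]
    [Module.Finite ℤ A] [Field F] [AddCommGroup U] [Module F U] (red : A →+ U)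
    (N : Submodule ℤ A) {k : ℕ} (hN : Module.finrank ℤ N ≤ k) :
    ∃ g : Fin k → U, ∀ a ∈ N, red a ∈ Submodule.span F (Set.range g) := by
  let b := Module.finBasis ℤ N
  let g : Fin k → U := fun j =>
    if h : (j : ℕ) < Module.finrank ℤ N then red (b ⟨j, h⟩) else 0
  refine ⟨g, fun a ha => ?_⟩
  have hsum : a = ∑ i, b.repr ⟨a, ha⟩ i • (b i : A) := by
    simpa only [map_sum, map_zsmul, Submodule.subtype_apply] using
      (congrArg N.subtype (b.sum_repr ⟨a, ha⟩)).symm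
  rw [hsum, map_sum]
  refine Submodule.sum_mem _ fun i _ => ?_
  rw [map_zsmul]
  refine zsmul_mem (Submodule.subset_span (Set.mem_range.mpr ⟨⟨i, i.2.trans_le hN⟩, ?_⟩)) _
  simp [g]

/-- The integer combination of `v 0, …, v n` whose coefficients are given as a pair: a vector for
the first `n` of them, and the coefficient of the last one. -/
def integerCombination {E : Type*} [AddCommGroup E] {n : ℕ} (v : Fin (n + 1) → E) :
    ((Fin n → ℤ) × ℤ) →ₗ[ℤ] E :=
  (Fintype.linearCombination ℤ fun i : Fin n => v i.castSucc).coprod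
    (LinearMap.toSpanSingleton ℤ E (v (Fin.last n)))

theorem integerCombination_apply {E : Type*} [AddCommGroup E] {n : ℕ} (v : Fin (n + 1) → E)
    (q : (Fin n → ℤ) × ℤ) :
    integerCombination v q = ∑ i : Fin n, q.1 i • v i.castSucc + q.2 • v (Fin.last n) := by
  simp [integerCombination, Fintype.linearCombination_apply]

theorem integerCombination_injective {E : Type*} [AddCommGroup E] [Module ℝ E] {n : ℕ}
    {v : Fin (n + 1) → E} (hv : LinearIndependent ℝ v) :
    Function.Injective (integerCombination v) := by
  have hvZ : LinearIndependent ℤ v := hv.restrict_scalars (by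
    simpa using Int.cast_injective)
  rw [injective_iff_map_eq_zero]
  rintro ⟨a, t⟩ h
  rw [integerCombination_apply] at h
  have h0 := Fintype.linearIndependent_iff.mp hvZ (Fin.snoc a t : Fin (n + 1) → ℤ)
    (by simpa [Fin.sum_univ_castSucc] using h)
  ext i
  · simpa using h0 i.castSucc
  · simpa using h0 (Fin.last n)

/-- Reduction modulo `p` of the coefficient pairs of `integerCombination`. -/
def reduceMod (n p : ℕ) : ((Fin n → ℤ) × ℤ) →+ (Fin n → ZMod p) × ZMod p :=
  AddMonoidHom.prodMap ((Int.castAddHom (ZMod p)).compLeft (Fin n)) (Int.castAddHom (ZMod p))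

/-- If `q` represents a nonzero multiple of `(y, 1)` modulo `p`, then a subspace contains the
reduction of `q` exactly if it contains `(y, 1)`. -/
theorem mem_of_reduceMod_mem {n p : ℕ} [Fact p.Prime]
    (W : Submodule (ZMod p) ((Fin n → ZMod p) × ZMod p)) {q : (Fin n → ℤ) × ℤ}
    {y : Fin n → ZMod p} (hpos : 0 < q.2) (hlt : q.2 < p)
    (hq : ∀ i, (q.1 i : ZMod p) = q.2 * y i) : reduceMod n p q ∈ W ↔ (y, 1) ∈ W := by
  have h1 : reduceMod n p q = (q.2 : ZMod p) • (y, (1 : ZMod p)) := by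
    ext i
    · simp [reduceMod, hq]
    · simp [reduceMod]
  have h2 : (q.2 : ZMod p) ≠ 0 := by
    rw [Ne, ZMod.intCast_zmod_eq_zero_iff_dvd]
    exact fun h => absurd (Int.le_of_dvd hpos h) (by omega)
  rw [h1, W.smul_mem_iff h2]

/-- Transfer from `ZMod p` to `ℝ`. The coefficient vectors of the lattice points in a real subspace
of dimension `k + 1` form a group of rank at most `k + 1`, which reduces into a span of `k + 1`
vectors over `ZMod p`; so a bound for the number of the points `(f i, 1)` in such spans carries over
to real subspaces. The same bound, for the span of a single vector, controls how often a point is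
repeated. -/
theorem image_integerCombination_few {E : Type*} [NormedAddCommGroup E] [NormedSpace ℝ E]
    [FiniteDimensional ℝ E] [DecidableEq E] {Λ : Submodule ℤ E} [DiscreteTopology Λ]
    {n p k N r : ℕ} [Fact p.Prime] {v : Fin (n + 1) → E} (hv : LinearIndependent ℝ v)
    (hvΛ : ∀ i, v i ∈ Λ)
    (w : (Fin n → ZMod p) → (Fin n → ℤ) × ℤ) (hpos : ∀ y, 0 < (w y).2) (hlt : ∀ y, (w y).2 < p)
    (hw : ∀ y i, ((w y).1 i : ZMod p) = (w y).2 * y i) (f : Fin N → Fin n → ZMod p)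
    (hf : ∀ g : Fin (k + 1) → (Fin n → ZMod p) × ZMod p,
      {i | (f i, (1 : ZMod p)) ∈ Submodule.span (ZMod p) (Set.range g)}.ncard < r) :
    N ≤ r * (Finset.univ.image fun i => integerCombination v (w (f i))).card ∧
      ∀ V : Submodule ℝ E, Module.finrank ℝ V = k + 1 →
        (((Finset.univ.image fun i => integerCombination v (w (f i)) : Finset E) : Set E) ∩
          (V : Set E)).ncard ≤ r - 1 := by
  constructor
  · have h := Finset.card_le_mul_card_image (f := fun i => integerCombination v (w (f i)))
      (Finset.univ : Finset (Fin N)) r ?_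
    · simpa using h
    intro x hx
    obtain ⟨j, -, rfl⟩ := Finset.mem_image.mp hx
    refine le_trans ?_ (hf fun _ => (f j, 1)).le
    rw [← Set.ncard_coe_finset]
    refine Set.ncard_le_ncard (fun i hi => ?_) (Set.toFinite _)
    have hi' : w (f i) = w (f j) :=
      integerCombination_injective hv (by simpa using hi)
    rw [Set.mem_ofPred, ← mem_of_reduceMod_mem _ (hpos (f i)) (hlt (f i)) (hw (f i)), hi',
      mem_of_reduceMod_mem _ (hpos (f j)) (hlt (f j)) (hw (f j))]
    exact Submodule.subset_span ⟨0, rfl⟩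
  · intro V hV
    set N' : Submodule ℤ ((Fin n → ℤ) × ℤ) :=
      (V.restrictScalars ℤ).comap (integerCombination v)
    have hrank : Module.finrank ℤ N' ≤ k + 1 := by
      rw [← hV, (Submodule.equivMapOfInjective _ (integerCombination_injective hv) N').finrank_eq]
      refine finrank_int_le_of_le (Λ := Λ) ?_ V ?_
      · rintro _ ⟨q, -, rfl⟩
        rw [integerCombination_apply]
        exact Λ.add_mem (Λ.sum_mem fun i _ => Λ.smul_mem _ (hvΛ _)) (Λ.smul_mem _ (hvΛ _))
      · rintro _ ⟨q, hq, rfl⟩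
        exact hq
    obtain ⟨g, hg⟩ := exists_span_reduction (F := ZMod p) (reduceMod n p) N' hrank
    have hsub : (((Finset.univ.image fun i => integerCombination v (w (f i)) : Finset E) : Set E) ∩
        (V : Set E)) ⊆ (fun i => integerCombination v (w (f i))) ''
          {i | (f i, (1 : ZMod p)) ∈ Submodule.span (ZMod p) (Set.range g)} := by
      rintro x ⟨hx, hxV⟩
      obtain ⟨i, -, rfl⟩ := Finset.mem_image.mp (Finset.mem_coe.mp hx)
      exact ⟨i, (mem_of_reduceMod_mem _ (hpos _) (hlt _) (hw _)).mp (hg _ hxV), rfl⟩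
    have := (Set.ncard_le_ncard hsub (Set.toFinite _)).trans (Set.ncard_image_le (Set.toFinite _))
    have := hf g
    omega

/-- There are `⌊p ^ (n - k - ε)⌋` points of the affine chart `(ZMod p) ^ n × {1}`, chosen with
repetition, fewer than `r` of which lie in any span of `k + 1` vectors. The constant `r` has to
satisfy `ε r > (n + 1) (k + 1)`, so that the number `p ^ ((n + 1) (k + 1))` of families `g` is
outweighed by `p ^ (ε r)`. -/
theorem exists_random_selection {n k p r : ℕ} [Fact p.Prime] {ε : ℝ}
    (hr : ((n + 1) * (k + 1) : ℕ) < ε * r) (hr0 : 0 < r) :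
    ∃ f : Fin ⌊(p : ℝ) ^ ((n : ℝ) - k - ε)⌋₊ → Fin n → ZMod p,
      ∀ g : Fin (k + 1) → (Fin n → ZMod p) × ZMod p,
        {i | (f i, (1 : ZMod p)) ∈ Submodule.span (ZMod p) (Set.range g)}.ncard < r := by
  classical
  set N := ⌊(p : ℝ) ^ ((n : ℝ) - k - ε)⌋₊
  have hp : (1 : ℝ) < p := by exact_mod_cast (Fact.out : p.Prime).one_lt
  have hp0 : (0 : ℝ) < p := by linarith
  have hN : (N : ℝ) ≤ (p : ℝ) ^ ((n : ℝ) - k - ε) := Nat.floor_le (Real.rpow_nonneg hp0.le _)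
  have hcount : Fintype.card (Fin (k + 1) → (Fin n → ZMod p) × ZMod p) * (N ^ r * (p ^ k) ^ r) <
      Fintype.card (Fin n → ZMod p) ^ r := by
    simp only [Fintype.card_fun, Fintype.card_prod, ZMod.card, Fintype.card_fin]
    have hR : (((p : ℝ) ^ n * p) ^ (k + 1)) * ((N : ℝ) ^ r * ((p : ℝ) ^ k) ^ r) <
        ((p : ℝ) ^ n) ^ r := by
      calc (((p : ℝ) ^ n * p) ^ (k + 1)) * ((N : ℝ) ^ r * ((p : ℝ) ^ k) ^ r)
          ≤ (((p : ℝ) ^ n * p) ^ (k + 1)) *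
            (((p : ℝ) ^ ((n : ℝ) - k - ε)) ^ r * ((p : ℝ) ^ k) ^ r) := by gcongr
        _ = (p : ℝ) ^ ((((n + 1) * (k + 1) : ℕ) : ℝ) +
              (((n : ℝ) - k - ε) * r + ((k * r : ℕ) : ℝ))) := by
            rw [Real.rpow_add hp0, Real.rpow_add hp0, Real.rpow_natCast, Real.rpow_natCast,
              Real.rpow_mul hp0.le, Real.rpow_natCast, ← pow_succ, ← pow_mul, ← pow_mul]
        _ < (p : ℝ) ^ ((n * r : ℕ) : ℝ) := by
            refine Real.rpow_lt_rpow_of_exponent_lt hp ?_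
            push_cast at hr ⊢
            nlinarith
        _ = ((p : ℝ) ^ n) ^ r := by rw [Real.rpow_natCast, pow_mul]
    exact_mod_cast hR
  obtain ⟨f, hf⟩ := exists_function_card_hits_lt (N := N)
    (fun g : Fin (k + 1) → (Fin n → ZMod p) × ZMod p => Finset.univ.filter fun y =>
      (y, (1 : ZMod p)) ∈ Submodule.span (ZMod p) (Set.range g)) hr0
    (fun g => (card_slice_span_le g _ (by simp)).trans_eq (by rw [ZMod.card])) hcount
  refine ⟨f, fun g => ?_⟩
  have := hf g
  rw [← Set.ncard_coe_finset] at this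
  simpa using this

/-! ### Representatives inside the convex body -/

theorem minimaBeta_nonneg {d : ℕ} {Λ : Submodule ℤ (EuclideanSpace ℝ (Fin d))}
    {K : ConvexBody (EuclideanSpace ℝ (Fin d))} (h : ∀ i, 0 ≤ successiveMinimum Λ K i) :
    0 ≤ minimaBeta Λ K := by
  refine Real.sInf_nonneg ?_
  rintro _ ⟨j, -, rfl⟩
  exact Real.rpow_nonneg (Finset.prod_nonneg fun i _ => h i) _

theorem minimaBeta_pow_mul_prod_le {n : ℕ} {Λ : Submodule ℤ (EuclideanSpace ℝ (Fin (n + 1)))}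
    {K : ConvexBody (EuclideanSpace ℝ (Fin (n + 1)))} (h : ∀ i, 0 ≤ successiveMinimum Λ K i)
    (hpos : ∀ i, 1 ≤ i → i ≤ n + 1 → 0 < successiveMinimum Λ K i) {j : ℕ} (hj : j < n) :
    minimaBeta Λ K ^ (n - j) * ∏ i ∈ Finset.Icc (j + 1) (n + 1), successiveMinimum Λ K i ≤ 1 := by
  set P := ∏ i ∈ Finset.Icc (j + 1) (n + 1), successiveMinimum Λ K i with hP
  have hPpos : 0 < P := Finset.prod_pos fun i hi => by
    obtain ⟨h1, h2⟩ := Finset.mem_Icc.mp hi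
    exact hpos i (by omega) h2
  have hm : ((n - j : ℕ) : ℝ) ≠ 0 := by
    rw [Nat.cast_ne_zero]; omega
  have hle : minimaBeta Λ K ≤ P ^ (-1 / ((n - j : ℕ) : ℝ)) := by
    refine csInf_le ((Set.finite_Icc _ _).image _).bddBelow ⟨j + 1, ⟨by omega, by omega⟩, ?_⟩
    simp only [← hP]
    congr 2
    push_cast [Nat.cast_sub hj.le]
    ring
  have hpow : minimaBeta Λ K ^ (n - j) ≤ P⁻¹ := by
    refine (pow_le_pow_left₀ (minimaBeta_nonneg h) hle _).trans_eq ?_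
    rw [← Real.rpow_natCast, ← Real.rpow_mul hPpos.le, div_mul_cancel₀ _ hm, Real.rpow_neg_one]
  calc minimaBeta Λ K ^ (n - j) * P ≤ P⁻¹ * P := by gcongr
    _ = 1 := inv_mul_cancel₀ hPpos.ne'

/-- The box with sides `δ / ((n + 1) λ_i)` for the first `n` coordinates and
`max 1 (1 / (2 (n + 1) λ_d))` for the last one satisfies the product hypothesis of
`prod_ceil_le_and_lt` for every `p` of size at most a constant times `δ β`. -/
theorem two_mul_pow_le_prod_box {n j p : ℕ} (hj : j < n) {l : ℕ → ℝ} {δ β : ℝ} (hδ : 0 ≤ δ)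
    (hl : ∀ i, 1 ≤ i → i ≤ n + 1 → 0 < l i)
    (hprod : β ^ (n - j) * ∏ i ∈ Finset.Icc (j + 1) (n + 1), l i ≤ 1)
    (hp : 4 * ((n : ℝ) + 1) ^ 2 * p ≤ δ * β) :
    (2 * (p : ℝ)) ^ (n - j) ≤ (∏ i ∈ Finset.Ico j n, δ / ((n + 1) * l (i + 1))) *
      max 1 (1 / (2 * (n + 1) * l (n + 1))) := by
  set Q := ∏ i ∈ Finset.Ico j n, l (i + 1) with hQ
  have hQpos : 0 < Q := Finset.prod_pos fun i hi => by
    have := (Finset.mem_Ico.mp hi).2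
    exact hl _ (by omega) (by omega)
  have hlast := hl (n + 1) (by omega) le_rfl
  have hsplit : ∏ i ∈ Finset.Icc (j + 1) (n + 1), l i = Q * l (n + 1) := by
    rw [← Finset.Ico_add_one_right_eq_Icc, Finset.prod_Ico_succ_top (by omega), hQ,
      Finset.prod_Ico_add']
  have hn : (0 : ℝ) < n + 1 := by positivity
  have hm : n - j ≠ 0 := by omega
  have hbox : ∏ i ∈ Finset.Ico j n, δ / ((n + 1) * l (i + 1)) = (δ / (n + 1)) ^ (n - j) / Q := by
    rw [hQ, ← Nat.card_Ico, ← Finset.prod_const, ← Finset.prod_div_distrib]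
    exact Finset.prod_congr rfl fun i _ => (div_div _ _ _).symm
  have hβQ : β ^ (n - j) ≤ 1 / (Q * l (n + 1)) := by
    rw [le_div_iff₀ (mul_pos hQpos hlast), ← hsplit]
    exact hprod
  have hinv : (1 / (2 * ((n : ℝ) + 1))) ^ (n - j) ≤ 1 / (2 * ((n : ℝ) + 1)) := by
    refine pow_le_of_le_one (by positivity) ?_ hm
    rw [div_le_one (by positivity)]
    linarith [(Nat.cast_nonneg n : (0 : ℝ) ≤ n)]
  have h2p : 2 * (p : ℝ) ≤ δ / (n + 1) * β * (1 / (2 * (n + 1))) := by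
    rw [show δ / (n + 1) * β * (1 / (2 * ((n : ℝ) + 1))) = δ * β / (2 * (n + 1) ^ 2) by
      field_simp, le_div_iff₀ (by positivity)]
    linarith
  calc (2 * (p : ℝ)) ^ (n - j) ≤ (δ / (n + 1) * β * (1 / (2 * (n + 1)))) ^ (n - j) := by
        gcongr
    _ = (δ / (n + 1)) ^ (n - j) * β ^ (n - j) * (1 / (2 * (n + 1))) ^ (n - j) := by
        rw [mul_pow, mul_pow]
    _ ≤ (δ / (n + 1)) ^ (n - j) * (1 / (Q * l (n + 1))) * (1 / (2 * (n + 1))) := by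
        gcongr
    _ = (δ / (n + 1)) ^ (n - j) / Q * (1 / (2 * (n + 1) * l (n + 1))) := by
        field_simp
    _ ≤ _ := by
        rw [hbox]
        gcongr
        exact le_max_right _ _

/-- For every `y` in `(ZMod p) ^ n`, some nonzero multiple of `(y, 1)` lifts to a lattice point of
`K`, when `p` is at most a constant times `(1 - λ_d) β`. -/
theorem exists_representatives_mem {n p : ℕ} [Fact p.Prime]
    {Λ : Submodule ℤ (EuclideanSpace ℝ (Fin (n + 1)))} [DiscreteTopology Λ] [IsZLattice ℝ Λ]
    {K : ConvexBody (EuclideanSpace ℝ (Fin (n + 1)))}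
    (hsymm : -(K : Set (EuclideanSpace ℝ (Fin (n + 1)))) = K)
    (hK : (K : Set (EuclideanSpace ℝ (Fin (n + 1)))) ∈ 𝓝 0)
    (hlt : successiveMinimum Λ K (n + 1) < 1)
    (hp : 4 * ((n : ℝ) + 1) ^ 2 * p ≤ (1 - successiveMinimum Λ K (n + 1)) * minimaBeta Λ K)
    (v : Fin (n + 1) → EuclideanSpace ℝ (Fin (n + 1)))
    (hv : ∀ i, gauge K (v i) ≤ successiveMinimum Λ K (i + 1)) :
    ∃ w : (Fin n → ZMod p) → (Fin n → ℤ) × ℤ, ∀ y, 0 < (w y).2 ∧ (w y).2 < p ∧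
      (∀ i, ((w y).1 i : ZMod p) = (w y).2 * y i) ∧ integerCombination v (w y) ∈ K := by
  set l := successiveMinimum Λ K with hl
  set δ := 1 - l (n + 1) with hδ
  have hpos : ∀ i, 1 ≤ i → i ≤ n + 1 → 0 < l i := fun i h1 h2 => successiveMinimum_pos hK h2 h1
  have hnn : ∀ i, 0 ≤ l i := fun i => Real.sInf_nonneg fun t ht => ht.1
  have hlast := hpos (n + 1) (by omega) le_rfl
  have hδ0 : 0 < δ := by linarith
  have hn : (0 : ℝ) < n + 1 := by positivity
  -- The first `n` coordinates use up at most `n δ / (n + 1)` of the gauge. The last coefficient may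
  -- always be `1`, at cost `λ_d = 1 - δ`; when `λ_d` is small, it may be as large as
  -- `1 / (2 (n + 1) λ_d)`.
  set M : ℕ → ℝ := fun i => δ / ((n + 1) * l (i + 1)) with hM
  set D : ℝ := max 1 (1 / (2 * (n + 1) * l (n + 1))) with hD
  have hMpos : ∀ i < n, 0 < M i := fun i hi =>
    div_pos hδ0 (mul_pos hn (hpos _ (by omega) (by omega)))
  have hanti : ∀ i j, i ≤ j → j < n → M j ≤ M i := by
    intro i j hij hj
    have h1 := hpos (i + 1) (by omega) (by omega)
    have h2 : l (i + 1) ≤ l (j + 1) := successiveMinimum_mono hK (by omega) (by omega)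
    simp only [hM]
    gcongr
  have hDM : D = 1 ∨ ∀ i < n, D ≤ M i := by
    rcases le_total (1 / (2 * (n + 1) * l (n + 1))) 1 with h | h
    · exact Or.inl (max_eq_left h)
    · right
      intro i hi
      have h1 := hpos (i + 1) (by omega) (by omega)
      have h2 : l (i + 1) ≤ l (n + 1) := successiveMinimum_mono hK (by omega) le_rfl
      -- In this case `λ_d ≤ 1 / (2 (n + 1)) ≤ 1 / 2`.
      have h3 : 1 / 2 ≤ δ := by
        rw [le_div_iff₀ (by positivity)] at h
        nlinarith [(Nat.cast_nonneg n : (0 : ℝ) ≤ n)]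
      rw [hD, max_eq_right h]
      calc 1 / (2 * ((n : ℝ) + 1) * l (n + 1)) = (1 / 2) / ((n + 1) * l (n + 1)) := by
            field_simp
        _ ≤ δ / ((n + 1) * l (i + 1)) := by gcongr
  obtain ⟨hTD, hTp⟩ := prod_ceil_le_and_lt (Fact.out : p.Prime).one_lt M D hMpos hanti
    (le_max_left _ _) hDM fun j hj => two_mul_pow_le_prod_box hj hδ0.le hpos
      (minimaBeta_pow_mul_prod_le hnn hpos hj) hp
  have hrep := fun y : Fin n → ZMod p =>
    exists_small_multiple (fun i : Fin n => M i) (fun i => hMpos i i.2) y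
  choose t ht0 htT a haM hat using hrep
  have hT : ∏ i : Fin n, (⌈(p : ℝ) / M i⌉₊ : ℤ) =
      ((∏ i ∈ Finset.range n, ⌈(p : ℝ) / M i⌉₊ : ℕ) : ℤ) := by
    rw [Finset.prod_range]
    push_cast
    rfl
  rw [hT] at htT
  refine ⟨fun y => (a y, t y), fun y =>
    ⟨ht0 y, (htT y).trans_lt (by exact_mod_cast hTp), hat y, ?_⟩⟩
  have htD : (t y : ℝ) ≤ D := le_trans (by exact_mod_cast htT y) hTD
  have ht0' : (0 : ℝ) < t y := by exact_mod_cast ht0 y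
  have hgauge : gauge K (integerCombination v (a y, t y)) ≤ 1 := by
    have h1 := gauge_sum_zsmul_le K.convex hsymm hK Finset.univ
      (Fin.snoc (a y) (t y) : Fin (n + 1) → ℤ) v
    simp only [Fin.sum_univ_castSucc, Fin.snoc_castSucc, Fin.snoc_last] at h1
    rw [integerCombination_apply]
    refine h1.trans ?_
    have h2 : ∀ i : Fin n, |(a y i : ℝ)| * gauge K (v i.castSucc) ≤ δ / (n + 1) := by
      intro i
      have h3 := hpos (i + 1) (by omega) (by omega)
      calc |(a y i : ℝ)| * gauge K (v i.castSucc) ≤ M i * l (i + 1) := by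
            gcongr
            · exact gauge_nonneg _
            · exact haM y i
            · exact hv i.castSucc
        _ = δ / (n + 1) := by
            simp only [hM]
            field_simp
    have h3 : ∑ i : Fin n, |(a y i : ℝ)| * gauge K (v i.castSucc) ≤ n * (δ / (n + 1)) :=
      (Finset.sum_le_sum fun i _ => h2 i).trans_eq (by simp)
    have h4 : |(t y : ℝ)| * gauge K (v (Fin.last n)) ≤ D * l (n + 1) := by
      rw [abs_of_pos ht0']
      gcongr
      · exact gauge_nonneg _
      · simpa using hv (Fin.last n)
    have h5 : D * l (n + 1) = max (l (n + 1)) (1 / (2 * (n + 1))) := by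
      rw [hD, max_mul_of_nonneg _ _ hlast.le, one_mul]
      congr 1
      field_simp
    have h6 : n * (δ / (n + 1)) + D * l (n + 1) ≤ 1 := by
      have hδ1 : n * (δ / (n + 1)) = δ - δ / (n + 1) := by field_simp; ring
      rcases le_total (l (n + 1)) (1 / (2 * ((n : ℝ) + 1))) with h | h
      · rw [h5, max_eq_right h]
        have h7 : n * (δ / (n + 1)) ≤ n * (1 / (n + 1)) := by
          gcongr
          linarith
        have h8 : n * (1 / ((n : ℝ) + 1)) + 1 / (2 * (n + 1)) ≤ 1 := by
          rw [show n * (1 / ((n : ℝ) + 1)) + 1 / (2 * (n + 1)) = (2 * n + 1) / (2 * (n + 1)) by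
            field_simp, div_le_one (by positivity)]
          linarith
        linarith
      · rw [h5, max_eq_left h, hδ1]
        have : 0 ≤ δ / (n + 1) := by positivity
        linarith
    linarith
  have := (mem_smul_iff_gauge_le K.convex K.isCompact hK zero_le_one _).mpr hgauge
  rwa [one_smul] at this

theorem exists_prime_near {q : ℝ} (hq : 1 ≤ q) : ∃ p : ℕ, p.Prime ∧ q ≤ p ∧ (p : ℝ) ≤ 2 * q := by
  obtain ⟨p, hp, h1, h2⟩ := Nat.exists_prime_lt_and_le_two_mul ⌊q⌋₊ (Nat.floor_pos.mpr hq).ne'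
  refine ⟨p, hp, (Nat.lt_of_floor_lt h1).le, ?_⟩
  calc (p : ℝ) ≤ 2 * (⌊q⌋₊ : ℝ) := by exact_mod_cast h2
    _ ≤ 2 * q := by gcongr; exact Nat.floor_le (by linarith)

theorem theorem3 (d k : ℕ) (hk : 1 ≤ k) (hkd : k ≤ d - 1) (ε : ℝ) (hε : ε ∈ Set.Ioo (0 : ℝ) 1) :
    ∃ r : ℕ, 0 < r ∧ ∃ c : ℝ, 0 < c ∧
      ∀ (Λ : Submodule ℤ (EuclideanSpace ℝ (Fin d))) [DiscreteTopology Λ] [IsZLattice ℝ Λ]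
        (K : ConvexBody (EuclideanSpace ℝ (Fin d))),
        -(K : Set (EuclideanSpace ℝ (Fin d))) = (K : Set (EuclideanSpace ℝ (Fin d))) →
        (interior (K : Set (EuclideanSpace ℝ (Fin d)))).Nonempty →
        successiveMinimum Λ K d ≤ 1 →
        ∃ S : Finset (EuclideanSpace ℝ (Fin d)),
          (S : Set (EuclideanSpace ℝ (Fin d))) ⊆
            (Λ : Set (EuclideanSpace ℝ (Fin d))) ∩ (K : Set (EuclideanSpace ℝ (Fin d))) ∧
          c * ((1 - successiveMinimum Λ K d) * minimaBeta Λ K) ^ ((d : ℝ) - (k : ℝ) - ε)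
            ≤ (S.card : ℝ) ∧
          ∀ V : Submodule ℝ (EuclideanSpace ℝ (Fin d)), Module.finrank ℝ V = k →
            ((S : Set (EuclideanSpace ℝ (Fin d))) ∩
              (V : Set (EuclideanSpace ℝ (Fin d)))).ncard ≤ r - 1 := by
  classical
  obtain ⟨n, rfl⟩ : ∃ n, d = n + 1 := ⟨d - 1, by omega⟩
  obtain ⟨k, rfl⟩ : ∃ k', k = k' + 1 := ⟨k - 1, by omega⟩
  have hkn : (k : ℝ) + 1 ≤ n := by
    have : k + 1 ≤ n := by omega
    exact_mod_cast this
  obtain ⟨r, hr⟩ := exists_nat_gt (max 2 (((n + 1) * (k + 1) : ℕ) / ε))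
  have hr2 : 2 < r := by exact_mod_cast (le_max_left _ _).trans_lt hr
  have hrε : ((n + 1) * (k + 1) : ℕ) < ε * r := by
    have := (le_max_right _ _).trans_lt hr
    rw [div_lt_iff₀ hε.1] at this
    linarith
  set e : ℝ := (n : ℝ) - k - ε with he
  have hee : ((n + 1 : ℕ) : ℝ) - ((k + 1 : ℕ) : ℝ) - ε = e := by push_cast; ring
  have he0 : 0 < e := by linarith [hε.2]
  set C : ℝ := 8 * ((n : ℝ) + 1) ^ 2 with hC
  have hC0 : 0 < C := by positivity
  have hrpos : (2 : ℝ) < r := by exact_mod_cast hr2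
  refine ⟨r, by omega, 1 / (2 * r * C ^ e), by positivity, ?_⟩
  intro Λ _ _ K hsymm hint hle
  rw [hee]
  have hK : (K : Set (EuclideanSpace ℝ (Fin (n + 1)))) ∈ 𝓝 0 :=
    mem_interior_iff_mem_nhds.mp (zero_mem_interior_of_neg_eq K.convex hsymm hint)
  set q := (1 - successiveMinimum Λ K (n + 1)) * minimaBeta Λ K with hq
  have hβ : 0 ≤ minimaBeta Λ K :=
    minimaBeta_nonneg fun i => Real.sInf_nonneg fun t ht => ht.1
  have hq0 : 0 ≤ q := mul_nonneg (by linarith) hβ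
  have hscale : 1 / (2 * r * C ^ e) * q ^ e = (q / C) ^ e / 2 / r := by
    rw [Real.div_rpow hq0 hC0.le]
    field_simp
  rw [hscale]
  -- If `q` is bounded by the constant `C`, one point is enough; this covers the case
  -- `λ_d = 1`, where `q = 0`.
  rcases lt_or_ge (q / C) 1 with hsmall | hbig
  · refine ⟨{0}, ?_, ?_, fun V _ => ?_⟩
    · rw [Finset.coe_singleton, Set.singleton_subset_iff]
      exact ⟨Λ.zero_mem, mem_of_mem_nhds hK⟩
    · have h1 : (q / C) ^ e ≤ 1 := Real.rpow_le_one (by positivity) hsmall.le he0.le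
      rw [Finset.card_singleton, Nat.cast_one, div_le_one (by linarith)]
      linarith
    · refine (Set.ncard_le_ncard Set.inter_subset_left (Finset.finite_toSet _)).trans ?_
      rw [Set.ncard_coe_finset, Finset.card_singleton]
      omega
  · have hlt : successiveMinimum Λ K (n + 1) < 1 := by
      refine hle.lt_of_ne fun h => ?_
      rw [hq, h] at hbig
      norm_num at hbig
    obtain ⟨p, hp, hpq, hp2⟩ := exists_prime_near hbig
    have : Fact p.Prime := ⟨hp⟩
    obtain ⟨v, hv, hvΛ⟩ := exists_linearIndependent_successiveMinimum (Λ := Λ) hK le_rfl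
    have hpC : 4 * ((n : ℝ) + 1) ^ 2 * p ≤ q := by
      have h1 : (p : ℝ) * C ≤ 2 * q := by
        calc (p : ℝ) * C ≤ 2 * (q / C) * C := by gcongr
          _ = 2 * q := by field_simp
      rw [hC] at h1
      linarith
    obtain ⟨w, hw⟩ := exists_representatives_mem hsymm hK hlt hpC v fun i => (hvΛ i).2
    obtain ⟨f, hf⟩ := exists_random_selection (p := p) hrε (by omega)
    obtain ⟨hcard, hV⟩ := image_integerCombination_few hv (fun i => (hvΛ i).1) w
      (fun y => (hw y).1) (fun y => (hw y).2.1) (fun y => (hw y).2.2.1) f hf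
    refine ⟨_, ?_, ?_, hV⟩
    · intro x hx
      obtain ⟨i, -, rfl⟩ := Finset.mem_image.mp (Finset.mem_coe.mp hx)
      refine ⟨?_, (hw (f i)).2.2.2⟩
      rw [integerCombination_apply]
      exact Λ.add_mem (Λ.sum_mem fun i _ => Λ.smul_mem _ (hvΛ _).1) (Λ.smul_mem _ (hvΛ _).1)
    · have hp1 : (1 : ℝ) ≤ p := by exact_mod_cast hp.one_lt.le
      have h1 : (1 : ℝ) ≤ (p : ℝ) ^ e := Real.one_le_rpow hp1 he0.le
      have h2 : (q / C) ^ e ≤ (p : ℝ) ^ e := by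
        gcongr
      have h3 := Nat.lt_floor_add_one ((p : ℝ) ^ e)
      have h4 : (1 : ℝ) ≤ ⌊(p : ℝ) ^ e⌋₊ := by
        exact_mod_cast Nat.floor_pos.mpr h1
      rw [div_le_iff₀ (by linarith)]
      have h5 := (Nat.cast_le (α := ℝ)).mpr hcard
      rw [Nat.cast_mul, mul_comm] at h5
      refine le_trans ?_ h5
      linarith
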